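/- Let $k$ be a field. All Hopf algebras are over $k$ and cocommutative; $S$ denotes the antipode and $\Delta(a)=a_{(1)}\otimes a_{(2)}$ the comultiplication (Sweedler notation). Let $H,K$ be Hopf algebras. If $K$ is a left $H$-module algebra via an action $\rightharpoonup$, a *bijective 1-cocycle* is a coalgebra isomorphism $\pi:H\to K$ with $\pi(gh)=\pi(g_{(1)})\,(g_{(2)}\rightharpoonup\pi(h))$ for all $g,h\in H$. If $K$ is a left $H$-module bialgebra via $\rightharpoonup$, a *relative Rota–Baxter operator* with respect to $(K,\rightharpoonup)$ is a coalgebra homomorphism $\tau:K\to H$ with $\tau(a)\tau(b)=\tau\big(a_{(1)}(\tau(a_{(2)})\rightharpoonup b)\big)$ for all $a,b\in K$. A *Hopf brace* $(K,\cdot,\circ)$ consists of two Hopf algebra structures $(K,\cdot)$, with antipode $S$, and $K_\circ=(K,\circ)$ on the same coalgebra $K$ such that $a\circ(bc)=(a_{(1)}\circ b)\,S(a_{(2)})\,(a_{(3)}\circ c)$ for all $a,b,c$; given a Hopf brace, write $a\rightharpoonup_\circ b=S(a_{(1)})(a_{(2)}\circ b)$. A *Rota–Baxter operator* on a Hopf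 algebra $H$ is a coalgebra homomorphism $B:H\to H$ with $B(x)B(y)=B\big(x_{(1)}B(x_{(2)})\,y\,S(B(x_{(3)}))\big)$ for all $x,y\in H$. 1. Let $\pi:H\to K$ be a bijective 1-cocycle with respect to a left $H$-module algebra structure on $K$. Then $a\circ_\pi b=\pi(\pi^{-1}(a)\pi^{-1}(b))$ is the second product of a Hopf brace $(K,\cdot,\circ_\pi)$, $K$ is a left $K_{\circ_\pi}$-module bialgebra via $\rightharpoonup_{\circ_\pi}$, and $\mathrm{id}_K:K\to K_{\circ_\pi}$ is a relative Rota–Baxter operator with respect to $(K,\rightharpoonup_{\circ_\pi})$. 2. Conversely, let $\tau:K\to H$ be a relative Rota–Baxter operator with respect to a left $H$-module bialgebra $(K,\rightharpoonup)$. Then $a\circ b=a_{(1)}(\tau(a_{(2)})\rightharpoonup b)$ is the second product of a Hopf brace $(K,\cdot,\circ)$, $K$ is a left $K_\circ$-module algebra via $\rightharpoonup_\circ$, and $\mathrm{id}_K:K_\circ\to K$ is a bijective 1-cocycle with respect to $\rightharpoonup_\circ$. 3. Let $B$ be a Rota–Baxter operator on a Hopf algebra $H$. Then $a\circ_B b=a_{(1)}B(a_{(2)})\,b\,S(B(a_{(3)}))$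 is the second product of a Hopf brace $(H,\cdot,\circ_B)$; with $H_B=(H,\circ_B)$, $H$ is a left $H_B$-module bialgebra via $\rightharpoonup_{\circ_B}$, and, with respect to this action, $\mathrm{id}_H:H\to H_B$ is a relative Rota–Baxter operator and $\mathrm{id}_H:H_B\to H$ is a bijective 1-cocycle. -/

import Mathlib

open scoped TensorProduct
open Coalgebra (comul counit)

universe u v w

namespace RBHopf

section Convolution

variable {k : Type u} [Field k]

/-- The convolution product of linear maps from a coalgebra to an algebra:
`conv f g c = f(c₁) g(c₂)` in Sweedler notation. -/
noncomputable def conv {C : Type v} {A : Type w} [AddCommGroup C] [Module k C] [Coalgebra k C]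
    [Ring A] [Algebra k A] (f g : C →ₗ[k] A) : C →ₗ[k] A :=
  LinearMap.mul' k A ∘ₗ TensorProduct.map f g ∘ₗ comul

end Convolution

/-- A Hopf algebra structure on a given coalgebra `C`: a bilinear associative unital product which,
together with the given comultiplication and counit, is a bialgebra, and an antipode. -/
structure HopfStructure (k : Type u) (C : Type v) [Field k] [AddCommGroup C] [Module k C]
    [Coalgebra k C] where
  /-- the product `a ∘ b` -/
  mul : C →ₗ[k] C →ₗ[k] C
  /-- the unit of the product -/
  one : C
  /-- the antipode `T` -/
  antipode : C →ₗ[k] C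
  mul_assoc : ∀ a b c, mul (mul a b) c = mul a (mul b c)
  one_mul : ∀ a, mul one a = a
  mul_one : ∀ a, mul a one = a
  /-- `Δ(a ∘ b) = (a₁ ∘ b₁) ⊗ (a₂ ∘ b₂)` -/
  comul_mul : ∀ a b, (comul (mul a b) : C ⊗[k] C) = TensorProduct.map₂ mul mul (comul a) (comul b)
  comul_one : (comul one : C ⊗[k] C) = one ⊗ₜ[k] one
  counit_mul : ∀ a b, (counit (mul a b) : k) = counit a * counit b
  counit_one : (counit one : k) = 1
  /-- `T(a₁) ∘ a₂ = ε(a) 1` -/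
  antipode_mul : ∀ a,
    TensorProduct.lift mul (TensorProduct.map antipode LinearMap.id (comul a : C ⊗[k] C)) =
      (counit a : k) • one
  /-- `a₁ ∘ T(a₂) = ε(a) 1` -/
  mul_antipode : ∀ a,
    TensorProduct.lift mul (TensorProduct.map LinearMap.id antipode (comul a : C ⊗[k] C)) =
      (counit a : k) • one

namespace HopfStructure

variable {k : Type u} {C : Type v} [Field k] [AddCommGroup C] [Module k C] [Coalgebra k C]

/-- The coalgebra `C`, regarded as a Hopf algebra (in Mathlib's sense) with the product of `s`. -/
def Carrier (_s : HopfStructure k C) : Type v := C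

variable (s : HopfStructure k C)

instance : AddCommGroup s.Carrier := inferInstanceAs (AddCommGroup C)

instance : Module k s.Carrier := inferInstanceAs (Module k C)

instance : Ring s.Carrier :=
  { (inferInstance : AddCommGroup s.Carrier) with
    mul := fun a b => s.mul a b
    one := s.one
    mul_assoc := s.mul_assoc
    one_mul := s.one_mul
    mul_one := s.mul_one
    left_distrib := fun a b c => (s.mul a).map_add b c
    right_distrib := fun a b c => s.mul.map_add₂ a b c
    zero_mul := fun a => s.mul.map_zero₂ a
    mul_zero := fun a => (s.mul a).map_zero }

instance : Algebra k s.Carrier :=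
  Algebra.ofModule (fun r a b => s.mul.map_smul₂ r a b) (fun r a b => (s.mul a).map_smul r b)

instance : Coalgebra k s.Carrier := inferInstanceAs (Coalgebra k C)

/-- The product of `s`, regarded as a bilinear map on `s.Carrier`. -/
def mulCarrier : s.Carrier →ₗ[k] s.Carrier →ₗ[k] s.Carrier := s.mul

theorem map₂_mul_eq (x y : s.Carrier ⊗[k] s.Carrier) :
    TensorProduct.map₂ s.mulCarrier s.mulCarrier x y = x * y := by
  induction x with
  | zero => simp
  | add x x' hx hx' => simp [hx, hx', add_mul]
  | tmul a b =>
    induction y with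
    | zero => simp
    | add y y' hy hy' => rw [map_add, hy, hy', mul_add]
    | tmul c d =>
      rw [TensorProduct.map₂_apply_tmul, TensorProduct.map_tmul,
        Algebra.TensorProduct.tmul_mul_tmul]
      rfl

theorem lift_mul_eq (x : s.Carrier ⊗[k] s.Carrier) :
    TensorProduct.lift s.mulCarrier x = LinearMap.mul' k s.Carrier x := by
  induction x with
  | zero => simp
  | add x x' hx hx' => simp [hx, hx']
  | tmul a b => rfl

noncomputable instance : Bialgebra k s.Carrier :=
  Bialgebra.mk' k s.Carrier s.counit_one (fun {a b} => s.counit_mul a b) s.comul_one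
    (fun {a b} => (s.comul_mul a b).trans (s.map₂_mul_eq _ _))

noncomputable instance : HopfAlgebra k s.Carrier where
  antipode := s.antipode
  mul_antipode_rTensor_comul := by
    ext a
    exact (s.lift_mul_eq _).symm.trans ((s.antipode_mul a).trans
      (Algebra.algebraMap_eq_smul_one (A := s.Carrier) _).symm)
  mul_antipode_lTensor_comul := by
    ext a
    exact (s.lift_mul_eq _).symm.trans ((s.mul_antipode a).trans
      (Algebra.algebraMap_eq_smul_one (A := s.Carrier) _).symm)

instance [h : Coalgebra.IsCocomm k C] : Coalgebra.IsCocomm k s.Carrier := ⟨h.comm_comp_comul⟩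

/-- The identity map of `C`, as an isomorphism of coalgebras onto the Hopf algebra given by `s`. -/
noncomputable def idEquiv : C ≃ₗc[k] s.Carrier :=
  { CoalgEquiv.refl k C with }

end HopfStructure

section HopfAlgebras

variable {k : Type u} [Field k]
variable {H : Type v} [Ring H] [HopfAlgebra k H] {K : Type w} [Ring K] [HopfAlgebra k K]

/-- `K` is a left `H`-module algebra via the action `h ⇀ x = act h x`. -/
structure IsModuleAlgebra (act : H →ₗ[k] K →ₗ[k] K) : Prop where
  one_act : ∀ x, act 1 x = x
  mul_act : ∀ g h x, act (g * h) x = act g (act h x)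
  /-- `h ⇀ (xy) = (h₁ ⇀ x)(h₂ ⇀ y)` -/
  act_mul : ∀ h x y, act h (x * y) = conv (act.flip x) (act.flip y) h
  /-- `h ⇀ 1 = ε(h) 1` -/
  act_one : ∀ h, act h 1 = (counit h : k) • (1 : K)

/-- `K` is a left `H`-module bialgebra via `act`: a module algebra such that the action
`H ⊗ K → K` is also a morphism of coalgebras. -/
structure IsModuleBialgebra (act : H →ₗ[k] K →ₗ[k] K) : Prop extends IsModuleAlgebra act where
  /-- `Δ(h ⇀ x) = (h₁ ⇀ x₁) ⊗ (h₂ ⇀ x₂)` -/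
  comul_act : ∀ h x,
    (comul (act h x) : K ⊗[k] K) = TensorProduct.map₂ act act (comul h) (comul x)
  counit_act : ∀ h x, (counit (act h x) : k) = counit h * counit x

/-- `τ : K → H` is a relative Rota-Baxter operator with respect to the left `H`-module bialgebra
`(K, act)`. -/
structure IsRelativeRotaBaxter (act : H →ₗ[k] K →ₗ[k] K) (τ : K →ₗc[k] H) : Prop where
  moduleBialgebra : IsModuleBialgebra act
  /-- `τ(a)τ(b) = τ(a₁ (τ(a₂) ⇀ b))` -/
  mul_eq : ∀ a b, τ a * τ b = τ (conv LinearMap.id (act.flip b ∘ₗ (τ : K →ₗ[k] H)) a)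

/-- The coalgebra isomorphism `π : H → K` is a bijective 1-cocycle for the left `H`-module algebra
`(K, act)`. -/
structure IsBijectiveOneCocycle (act : H →ₗ[k] K →ₗ[k] K) (π : H ≃ₗc[k] K) : Prop where
  moduleAlgebra : IsModuleAlgebra act
  /-- `π(gh) = π(g₁)(g₂ ⇀ π(h))` -/
  map_mul : ∀ g h, π (g * h) = conv (π : H →ₗ[k] K) (act.flip (π h)) g

/-- `B : H → H` is a Rota-Baxter operator on the (cocommutative) Hopf algebra `H`. -/
def IsRotaBaxter (B : H →ₗc[k] H) : Prop :=
  -- `B(x)B(y) = B(x₁ B(x₂) y S(B(x₃)))`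
  ∀ x y, B x * B y =
    B (conv (LinearMap.mulRight k y ∘ₗ conv LinearMap.id (B : H →ₗ[k] H))
      (HopfAlgebra.antipode k ∘ₗ (B : H →ₗ[k] H)) x)

variable (k H) in
/-- A Hopf brace whose first Hopf algebra structure is the given one on `H`: a second Hopf algebra
structure `∘` on the coalgebra `H` which is compatible with the first. -/
structure HopfBrace extends HopfStructure k H where
  /-- `a ∘ (bc) = (a₁ ∘ b) S(a₂) (a₃ ∘ c)` -/
  compat : ∀ a b c,
    mul a (b * c) = conv (conv (mul.flip b) (HopfAlgebra.antipode k)) (mul.flip c) a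

/-- The action `a ⇀ b = S(a₁)(a₂ ∘ b)` of `(H, ∘)` on `H` for a Hopf brace `(H, ·, ∘)`. -/
noncomputable def HopfBrace.act (G : HopfBrace k H) : G.Carrier →ₗ[k] H →ₗ[k] H :=
  (LinearMap.mk₂ k (fun a b => conv (HopfAlgebra.antipode k) (G.mul.flip b) a)
    (fun _ _ _ => map_add _ _ _) (fun _ _ _ => map_smul _ _ _)
    (fun a b b' => by simp [conv, TensorProduct.map_add_right])
    (fun r a b => by simp [conv, TensorProduct.map_smul_right]) : H →ₗ[k] H →ₗ[k] H)

end HopfAlgebras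

end RBHopf

/-! A cocommutative Hopf algebra is a group object in cocommutative coalgebras, where the tensor
product is the categorical product (`pair_fst_snd`, `fst_comp_pair`, `snd_comp_pair`). So the
coalgebra maps `C → A` form a group under convolution, and a Sweedler identity between coalgebra
maps can be proved as an identity between points for every cocommutative `C`. It is read back at the
universal point, given by the projections from a tensor product.

For a relative Rota–Baxter operator the second product on points is `x ∘ y = x · (τ(x) ⇀ y)`, and
the Rota–Baxter identity says `τ(x)τ(y) = τ(x ∘ y)`. As for groups, this yields associativity and
the inverse `τ(x)⁻¹ ⇀ x⁻¹`. For a bijective 1-cocycle the second structure is transported from `H`,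
and the cocycle identity puts its product in the same form with `φ = π⁻¹` in place of `τ`.

From `a ∘ b = a₁(φ(a₂) ⇀ b)` everything else follows uniformly. Cancelling the antipode gives brace
compatibility (`HopfBrace.ofAction`) and identifies the brace action with the given action pulled
back along `φ`. It is thus a module algebra action, since `φ` is multiplicative for `∘`. It is also
a coalgebra map, being the convolution of the antipode and `∘` (`HopfBrace.isModuleBialgebra_act`).
The identity is then both a relative Rota–Baxter operator and a 1-cocycle, because both conditions
read `a ∘ b = a₁(a₂ ⇀ b)`. A Rota–Baxter operator on `H` is the case of the adjoint action. -/

namespace RBHopf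

open Coalgebra WithConv

/-! ### Tensor products as categorical products of cocommutative coalgebras -/

section Pairing

variable {k A B C D E X Y : Type*} [Field k]
  [AddCommGroup A] [Module k A] [Coalgebra k A] [AddCommGroup B] [Module k B] [Coalgebra k B]
  [AddCommGroup C] [Module k C] [Coalgebra k C] [AddCommGroup D] [Module k D] [Coalgebra k D]
  [AddCommGroup E] [Module k E] [Coalgebra k E]
  [AddCommGroup X] [Module k X] [AddCommGroup Y] [Module k Y]

variable (k A B) in
/-- The first projection of a tensor product of coalgebras. -/
noncomputable def fst : A ⊗[k] B →ₗc[k] A :=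
  ((Coalgebra.TensorProduct.rid k k A : (A ⊗[k] k) ≃ₗc[k] A) : (A ⊗[k] k) →ₗc[k] A).comp
    (Coalgebra.TensorProduct.map (CoalgHom.id k A) (counitCoalgHom k B))

variable (k A B) in
/-- The second projection of a tensor product of coalgebras. -/
noncomputable def snd : A ⊗[k] B →ₗc[k] B :=
  ((Coalgebra.TensorProduct.lid k B : (k ⊗[k] B) ≃ₗc[k] B) : (k ⊗[k] B) →ₗc[k] B).comp
    (Coalgebra.TensorProduct.map (counitCoalgHom k A) (CoalgHom.id k B))

@[simp]
theorem fst_tmul (a : A) (b : B) : fst k A B (a ⊗ₜ b) = (counit b : k) • a := rfl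

@[simp]
theorem snd_tmul (a : A) (b : B) : snd k A B (a ⊗ₜ b) = (counit a : k) • b := rfl

/-- The pairing of two homomorphisms out of a cocommutative coalgebra. -/
noncomputable def pair [IsCocomm k C] (f : C →ₗc[k] A) (g : C →ₗc[k] B) : C →ₗc[k] A ⊗[k] B :=
  (Coalgebra.TensorProduct.map f g).comp (comulCoalgHom k C)

theorem pair_apply [IsCocomm k C] (f : C →ₗc[k] A) (g : C →ₗc[k] B) (c : C) :
    pair f g c = TensorProduct.map (f : C →ₗ[k] A) (g : C →ₗ[k] B) (comul c) := rfl

theorem pair_comp [IsCocomm k C] [IsCocomm k D] (f : C →ₗc[k] A) (g : C →ₗc[k] B)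
    (φ : D →ₗc[k] C) : (pair f g).comp φ = pair (f.comp φ) (g.comp φ) := by
  ext d
  rw [CoalgHom.coe_comp, Function.comp_apply, pair_apply, pair_apply,
    ← CoalgHomClass.map_comp_comul_apply φ d, CoalgHom.comp_toLinearMap,
    CoalgHom.comp_toLinearMap, TensorProduct.map_comp]
  rfl

theorem comul_tmul_eq_map₂ (a : A) (b : B) :
    (comul (a ⊗ₜ[k] b) : (A ⊗[k] B) ⊗[k] (A ⊗[k] B)) =
      TensorProduct.map₂ (TensorProduct.mk k A B) (TensorProduct.mk k A B)
        (comul a) (comul b) := by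
  rw [TensorProduct.comul_tmul]
  generalize (comul a : A ⊗[k] A) = x
  generalize (comul b : B ⊗[k] B) = y
  induction x with
  | zero => simp
  | add x x' hx hx' => simp only [TensorProduct.add_tmul, map_add, hx, hx', LinearMap.add_apply]
  | tmul a a' =>
    induction y with
    | zero => simp
    | add y y' hy hy' => simp only [TensorProduct.tmul_add, map_add, hy, hy']
    | tmul b b' => rfl

/-- The projection applies a counit to one leg of `Δ(b)`, so only `a` remains split. This is how
convolutions on `A ⊗ B` become Sweedler expressions in `a` with `b` fixed. -/
theorem map_fst_comul_tmul (F : A →ₗ[k] X) (G : A ⊗[k] B →ₗ[k] Y) (a : A) (b : B) :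
    TensorProduct.map (F ∘ₗ (fst k A B : A ⊗[k] B →ₗ[k] A)) G (comul (a ⊗ₜ[k] b)) =
      TensorProduct.map F (G ∘ₗ (TensorProduct.mk k A B).flip b) (comul a) := by
  have key : ∀ (x : A ⊗[k] A) (y : B ⊗[k] B),
      TensorProduct.map (F ∘ₗ (fst k A B : A ⊗[k] B →ₗ[k] A)) G
        (TensorProduct.map₂ (TensorProduct.mk k A B) (TensorProduct.mk k A B) x y) =
      TensorProduct.map F (G ∘ₗ (TensorProduct.mk k A B).flip
        (TensorProduct.lid k B (LinearMap.rTensor B counit y))) x := by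
    intro x y
    induction x with
    | zero => simp
    | add x x' hx hx' => simp only [map_add, hx, hx', LinearMap.add_apply]
    | tmul a a' =>
      induction y with
      | zero => simp
      | add y y' hy hy' =>
        simp only [map_add, hy, hy', LinearMap.comp_add, TensorProduct.map_add_right,
          LinearMap.add_apply]
      | tmul b b' =>
        simp [TensorProduct.map₂_apply_tmul, TensorProduct.smul_tmul]
  rw [comul_tmul_eq_map₂, key, rTensor_counit_comul, TensorProduct.lid_tmul, one_smul]

theorem map_comul_tmul_fst (F : A →ₗ[k] X) (G : A ⊗[k] B →ₗ[k] Y) (a : A) (b : B) :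
    TensorProduct.map G (F ∘ₗ (fst k A B : A ⊗[k] B →ₗ[k] A)) (comul (a ⊗ₜ[k] b)) =
      TensorProduct.map (G ∘ₗ (TensorProduct.mk k A B).flip b) F (comul a) := by
  have key : ∀ (x : A ⊗[k] A) (y : B ⊗[k] B),
      TensorProduct.map G (F ∘ₗ (fst k A B : A ⊗[k] B →ₗ[k] A))
        (TensorProduct.map₂ (TensorProduct.mk k A B) (TensorProduct.mk k A B) x y) =
      TensorProduct.map (G ∘ₗ (TensorProduct.mk k A B).flip
        (TensorProduct.rid k B (LinearMap.lTensor B counit y))) F x := by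
    intro x y
    induction x with
    | zero => simp
    | add x x' hx hx' => simp only [map_add, hx, hx', LinearMap.add_apply]
    | tmul a a' =>
      induction y with
      | zero => simp
      | add y y' hy hy' =>
        simp only [map_add, hy, hy', LinearMap.comp_add, TensorProduct.map_add_left,
          LinearMap.add_apply]
      | tmul b b' =>
        simp [TensorProduct.map₂_apply_tmul, ← TensorProduct.smul_tmul']
  rw [comul_tmul_eq_map₂, key, lTensor_counit_comul, TensorProduct.rid_tmul, one_smul]

theorem pair_fst_snd [IsCocomm k A] [IsCocomm k B] :
    pair (fst k A B) (snd k A B) = CoalgHom.id k (A ⊗[k] B) := by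
  apply CoalgHom.coe_linearMap_injective
  ext a b
  have h := map_fst_comul_tmul (LinearMap.id : A →ₗ[k] A) (snd k A B : A ⊗[k] B →ₗ[k] B) a b
  have h' : (snd k A B : A ⊗[k] B →ₗ[k] B) ∘ₗ (TensorProduct.mk k A B).flip b =
      LinearMap.toSpanSingleton k B b ∘ₗ counit := by
    ext; simp
  rw [h', ← LinearMap.comp_id (LinearMap.id : A →ₗ[k] A), TensorProduct.map_comp,
    LinearMap.comp_apply] at h
  refine h.trans ?_
  have := lTensor_counit_comul (R := k) a
  rw [LinearMap.lTensor] at this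
  rw [this]
  simp

theorem fst_comp_pair [IsCocomm k C] (f : C →ₗc[k] A) (g : C →ₗc[k] B) :
    (fst k A B).comp (pair f g) = f := by
  ext c
  have h : (fst k A B : A ⊗[k] B →ₗ[k] A) ∘ₗ
      TensorProduct.map (f : C →ₗ[k] A) (g : C →ₗ[k] B) =
      (f : C →ₗ[k] A) ∘ₗ TensorProduct.rid k C ∘ₗ LinearMap.lTensor C counit := by
    ext; simp
  refine (LinearMap.congr_fun h (comul c)).trans ?_
  simp

theorem snd_comp_pair [IsCocomm k C] (f : C →ₗc[k] A) (g : C →ₗc[k] B) :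
    (snd k A B).comp (pair f g) = g := by
  ext c
  have h : (snd k A B : A ⊗[k] B →ₗ[k] B) ∘ₗ
      TensorProduct.map (f : C →ₗ[k] A) (g : C →ₗ[k] B) =
      (g : C →ₗ[k] B) ∘ₗ TensorProduct.lid k C ∘ₗ LinearMap.rTensor C counit := by
    ext; simp
  refine (LinearMap.congr_fun h (comul c)).trans ?_
  simp

theorem map_lift_comul_tmul (β : A →ₗ[k] B →ₗ[k] X) (γ : A →ₗ[k] B →ₗ[k] Y) (a : A) (b : B) :
    TensorProduct.map (TensorProduct.lift β) (TensorProduct.lift γ) (comul (a ⊗ₜ[k] b)) =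
      TensorProduct.map₂ β γ (comul a) (comul b) := by
  rw [comul_tmul_eq_map₂]
  generalize (comul a : A ⊗[k] A) = x
  generalize (comul b : B ⊗[k] B) = y
  induction x with
  | zero => simp
  | add x x' hx hx' => simp only [map_add, hx, hx', LinearMap.add_apply]
  | tmul a a' =>
    induction y with
    | zero => simp
    | add y y' hy hy' => simp only [map_add, hy, hy']
    | tmul b b' => simp [TensorProduct.map₂_apply_tmul]

/-- A bilinear map compatible with comultiplications and counits, as a homomorphism of coalgebras
on the tensor product. -/
noncomputable def liftCoalgHom (β : A →ₗ[k] B →ₗ[k] E)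
    (hΔ : ∀ a b, (comul (β a b) : E ⊗[k] E) = TensorProduct.map₂ β β (comul a) (comul b))
    (hε : ∀ a b, (counit (β a b) : k) = counit a * counit b) : A ⊗[k] B →ₗc[k] E where
  __ := TensorProduct.lift β
  counit_comp := by
    ext a b
    simp [hε, mul_comm]
  map_comp_comul := by
    ext a b
    exact (map_lift_comul_tmul β β a b).trans (hΔ a b).symm

theorem comul_apply_tmul (m : A ⊗[k] B →ₗc[k] E) (a : A) (b : B) :
    (comul (m (a ⊗ₜ b)) : E ⊗[k] E) =
      TensorProduct.map₂ (TensorProduct.curry (m : A ⊗[k] B →ₗ[k] E))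
        (TensorProduct.curry (m : A ⊗[k] B →ₗ[k] E)) (comul a) (comul b) := by
  have h : TensorProduct.lift (TensorProduct.curry (m : A ⊗[k] B →ₗ[k] E)) = m := by ext; rfl
  rw [← map_lift_comul_tmul, h]
  exact (CoalgHomClass.map_comp_comul_apply m _).symm

theorem counit_apply_tmul (m : A ⊗[k] B →ₗc[k] E) (a : A) (b : B) :
    (counit (m (a ⊗ₜ b)) : k) = counit a * counit b := by
  rw [CoalgHomClass.counit_comp_apply, TensorProduct.counit_tmul, smul_eq_mul, mul_comm]

end Pairing

/-! ### The convolution group of points -/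

section Points

variable {k A C : Type*} [Field k] [AddCommGroup C] [Module k C] [Coalgebra k C]

section Bialgebra

variable [Ring A] [Bialgebra k A]

theorem mul_eq_map₂_mul (x y : A ⊗[k] A) :
    TensorProduct.map₂ (LinearMap.mul k A) (LinearMap.mul k A) x y = x * y := by
  induction x with
  | zero => simp
  | add x x' hx hx' => simp only [map_add, hx, hx', LinearMap.add_apply, add_mul]
  | tmul a a' =>
    induction y with
    | zero => simp
    | add y y' hy hy' => simp only [map_add, hy, hy', mul_add]
    | tmul b b' => simp [TensorProduct.map₂_apply_tmul]

variable (k A) in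
/-- The product of a bialgebra, as a homomorphism of coalgebras. -/
noncomputable def mulCoalgHom : A ⊗[k] A →ₗc[k] A :=
  liftCoalgHom (LinearMap.mul k A)
    (fun a b => (Bialgebra.comul_mul a b).trans (mul_eq_map₂_mul _ _).symm)
    (fun a b => Bialgebra.counit_mul a b)

variable (k A) in
/-- The unit of a bialgebra, as a homomorphism of coalgebras. -/
noncomputable def unitCoalgHom : k →ₗc[k] A where
  __ := Algebra.linearMap k A
  counit_comp := by ext; simp
  map_comp_comul := by ext; simp [Algebra.TensorProduct.one_def]

noncomputable instance : One (WithConv (C →ₗc[k] A)) where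
  one := toConv ((unitCoalgHom k A).comp (counitCoalgHom k C))

theorem toLinearMap_one : toConv ((1 : WithConv (C →ₗc[k] A)).ofConv : C →ₗ[k] A) = 1 := rfl

theorem one_apply (c : C) :
    (1 : WithConv (C →ₗc[k] A)).ofConv c = algebraMap k A (counit c) := rfl

theorem toLinearMap_injective : Function.Injective
    (fun f : WithConv (C →ₗc[k] A) => toConv (f.ofConv : C →ₗ[k] A)) :=
  toConv_injective.comp (CoalgHom.coe_linearMap_injective.comp ofConv_injective)

variable [IsCocomm k C]

noncomputable instance : Mul (WithConv (C →ₗc[k] A)) where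
  mul f g := toConv ((mulCoalgHom k A).comp (pair f.ofConv g.ofConv))

theorem toLinearMap_mul (f g : WithConv (C →ₗc[k] A)) :
    toConv ((f * g).ofConv : C →ₗ[k] A) =
      toConv (f.ofConv : C →ₗ[k] A) * toConv (g.ofConv : C →ₗ[k] A) := rfl

noncomputable instance : Monoid (WithConv (C →ₗc[k] A)) where
  mul_assoc f g h := toLinearMap_injective (by simp only [toLinearMap_mul, mul_assoc])
  one_mul f := toLinearMap_injective (by simp only [toLinearMap_mul, toLinearMap_one, one_mul])
  mul_one f := toLinearMap_injective (by simp only [toLinearMap_mul, toLinearMap_one, mul_one])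

end Bialgebra

section Antipode

variable [Ring A] [HopfAlgebra k A] [IsCocomm k A] [IsCocomm k C]

/-- Both sides are convolution inverses of `comul` in `Hom(A, A ⊗ A)`. For the right-hand side, `(S
⊗ S) * (id ⊗ id) = (S * id) ⊗ (S * id)` is trivial on `A ⊗ A`, and precomposition with `Δ` preserves
convolution because cocommutativity makes `Δ` a coalgebra map. -/
theorem comul_comp_antipode :
    (comul : A →ₗ[k] A ⊗[k] A) ∘ₗ HopfAlgebra.antipode k =
      TensorProduct.map (HopfAlgebra.antipode k) (HopfAlgebra.antipode k) ∘ₗ comul := by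
  apply toConv_injective
  symm
  refine left_inv_eq_right_inv (a := toConv (comul : A →ₗ[k] A ⊗[k] A)) ?_
    LinearMap.comul_right_inv
  have h := LinearMap.convMul_comp_coalgHom_distrib
    (toConv (TensorProduct.map (HopfAlgebra.antipode k (A := A)) (HopfAlgebra.antipode k (A := A))))
    (toConv (TensorProduct.map (LinearMap.id : A →ₗ[k] A) (LinearMap.id : A →ₗ[k] A)))
    (comulCoalgHom k A)
  have h' := TensorProduct.map_convMul_map (f := toConv (HopfAlgebra.antipode k (A := A)))
    (h := toConv LinearMap.id) (g := toConv (HopfAlgebra.antipode k (A := A)))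
    (k := toConv LinearMap.id)
  simp only at h'
  rw [h', LinearMap.antipode_mul_id, TensorProduct.map_id, LinearMap.id_comp] at h
  refine (congrArg toConv h).symm.trans ?_
  have h1 : TensorProduct.map (1 : WithConv (A →ₗ[k] A)).ofConv
      (1 : WithConv (A →ₗ[k] A)).ofConv =
      (1 : WithConv (A ⊗[k] A →ₗ[k] A ⊗[k] A)).ofConv := by
    ext a b
    change algebraMap k A (counit a) ⊗ₜ[k] algebraMap k A (counit b) =
      algebraMap k (A ⊗[k] A) (counit (a ⊗ₜ[k] b))
    rw [Algebra.algebraMap_eq_smul_one, Algebra.algebraMap_eq_smul_one,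
      Algebra.algebraMap_eq_smul_one, TensorProduct.smul_tmul_smul, TensorProduct.counit_tmul,
      smul_eq_mul, mul_comm, Algebra.TensorProduct.one_def]
  rw [ofConv_toConv, h1]
  ext a
  exact congrArg (algebraMap k (A ⊗[k] A))
    (CoalgHomClass.counit_comp_apply (comulCoalgHom k A) a)

variable (k A) in
/-- The antipode of a cocommutative Hopf algebra, as a homomorphism of coalgebras. -/
noncomputable def antipodeCoalgHom : A →ₗc[k] A where
  __ := HopfAlgebra.antipode k
  counit_comp := HopfAlgebra.counit_comp_antipode
  map_comp_comul := comul_comp_antipode.symm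

/-- The group of points of a cocommutative Hopf algebra. -/
noncomputable instance : Group (WithConv (C →ₗc[k] A)) where
  inv f := toConv ((antipodeCoalgHom k A).comp f.ofConv)
  inv_mul_cancel f := by
    apply toLinearMap_injective
    have h := LinearMap.convMul_comp_coalgHom_distrib (toConv (HopfAlgebra.antipode k (A := A)))
      (toConv LinearMap.id) f.ofConv
    rw [LinearMap.antipode_mul_id] at h
    refine (congrArg toConv h).symm.trans ?_
    ext c
    exact congrArg (algebraMap k A) (CoalgHomClass.counit_comp_apply f.ofConv c)

end Antipode

end Points

/-! ### Operations on points and evaluation at the universal point -/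

section PointwiseOperations

variable {k A B C D E F G : Type*} [Field k]
  [AddCommGroup A] [Module k A] [Coalgebra k A] [AddCommGroup B] [Module k B] [Coalgebra k B]
  [AddCommGroup C] [Module k C] [Coalgebra k C] [IsCocomm k C]
  [AddCommGroup D] [Module k D] [Coalgebra k D]
  [AddCommGroup E] [Module k E] [Coalgebra k E] [AddCommGroup F] [Module k F] [Coalgebra k F]
  [AddCommGroup G] [Module k G] [Coalgebra k G]

/-- The operation on points induced by a homomorphism of coalgebras `A ⊗ B → E`. -/
noncomputable def pointOp (m : A ⊗[k] B →ₗc[k] E) (f : WithConv (C →ₗc[k] A))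
    (g : WithConv (C →ₗc[k] B)) : WithConv (C →ₗc[k] E) :=
  toConv (m.comp (pair f.ofConv g.ofConv))

/-- Composition of a point with a homomorphism of coalgebras. -/
def pointMap (φ : A →ₗc[k] B) (f : WithConv (C →ₗc[k] A)) : WithConv (C →ₗc[k] B) :=
  toConv (φ.comp f.ofConv)

/-- Restriction of a point along a homomorphism of coalgebras. -/
def pointComp (f : WithConv (C →ₗc[k] A)) (φ : D →ₗc[k] C) : WithConv (D →ₗc[k] A) :=
  toConv (f.ofConv.comp φ)

theorem pointOp_comp [IsCocomm k D] (m : A ⊗[k] B →ₗc[k] E) (f : WithConv (C →ₗc[k] A))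
    (g : WithConv (C →ₗc[k] B)) (φ : D →ₗc[k] C) :
    pointComp (pointOp m f g) φ = pointOp m (pointComp f φ) (pointComp g φ) := by
  apply WithConv.ext
  change (m.comp (pair f.ofConv g.ofConv)).comp φ = _
  rw [CoalgHom.comp_assoc, pair_comp]
  rfl

theorem map_comp_pair (φ : A →ₗc[k] D) (ψ : B →ₗc[k] E) (f : C →ₗc[k] A) (g : C →ₗc[k] B) :
    (Coalgebra.TensorProduct.map φ ψ).comp (pair f g) = pair (φ.comp f) (ψ.comp g) := by
  ext c
  rw [CoalgHom.coe_comp, Function.comp_apply, pair_apply, pair_apply, CoalgHom.comp_toLinearMap,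
    CoalgHom.comp_toLinearMap, TensorProduct.map_comp]
  rfl

theorem pointOp_fst_snd [IsCocomm k A] [IsCocomm k B] (m : D ⊗[k] E →ₗc[k] F)
    (φ : A →ₗc[k] D) (ψ : B →ₗc[k] E) :
    pointOp m (toConv (φ.comp (fst k A B))) (toConv (ψ.comp (snd k A B))) =
      toConv (m.comp (Coalgebra.TensorProduct.map φ ψ)) := by
  change toConv (m.comp (pair (φ.comp (fst k A B)) (ψ.comp (snd k A B)))) = _
  rw [← map_comp_pair, pair_fst_snd, CoalgHom.comp_id]

theorem pointOp_fst_snd_apply [IsCocomm k A] [IsCocomm k B] (m : D ⊗[k] E →ₗc[k] F)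
    (φ : A →ₗc[k] D) (ψ : B →ₗc[k] E) (a : A) (b : B) :
    (pointOp m (toConv (φ.comp (fst k A B))) (toConv (ψ.comp (snd k A B)))).ofConv (a ⊗ₜ b) =
      m (φ a ⊗ₜ ψ b) := by
  rw [pointOp_fst_snd]
  rfl

theorem pointOp_pointOp_left_apply [IsCocomm k A] [IsCocomm k B] [IsCocomm k D]
    (m : A ⊗[k] B →ₗc[k] E) (n : E ⊗[k] D →ₗc[k] F) (a : A) (b : B) (d : D) :
    (pointOp n (pointOp m
      (toConv ((fst k A B).comp (fst k (A ⊗[k] B) D)))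
      (toConv ((snd k A B).comp (fst k (A ⊗[k] B) D))))
      (toConv (snd k (A ⊗[k] B) D))).ofConv ((a ⊗ₜ b) ⊗ₜ d) = n (m (a ⊗ₜ b) ⊗ₜ d) := by
  have h : pointOp m (toConv ((fst k A B).comp (fst k (A ⊗[k] B) D)))
      (toConv ((snd k A B).comp (fst k (A ⊗[k] B) D))) =
      toConv (m.comp (fst k (A ⊗[k] B) D)) := by
    apply WithConv.ext
    change m.comp (pair _ _) = _
    rw [← pair_comp, pair_fst_snd, CoalgHom.id_comp]
  rw [h]
  exact pointOp_fst_snd_apply n m (CoalgHom.id k D) (a ⊗ₜ b) d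

theorem pointOp_pointOp_right_apply [IsCocomm k A] [IsCocomm k B] [IsCocomm k D]
    (m : B ⊗[k] D →ₗc[k] E) (n : A ⊗[k] E →ₗc[k] F) (a : A) (b : B) (d : D) :
    (pointOp n (toConv ((fst k A B).comp (fst k (A ⊗[k] B) D)))
      (pointOp m
      (toConv ((snd k A B).comp (fst k (A ⊗[k] B) D)))
      (toConv (snd k (A ⊗[k] B) D)))).ofConv ((a ⊗ₜ b) ⊗ₜ d) = n (a ⊗ₜ m (b ⊗ₜ d)) := by
  -- Reassociating expresses all three projections through those of `A ⊗ (B ⊗ D)`, for which the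
  -- inner pair is a single projection.
  let α : (A ⊗[k] B) ⊗[k] D →ₗc[k] A ⊗[k] (B ⊗[k] D) :=
    (Coalgebra.TensorProduct.assoc k k A B D : ((A ⊗[k] B) ⊗[k] D) ≃ₗc[k] _)
  have h1 : (fst k A B).comp (fst k (A ⊗[k] B) D) = (fst k A (B ⊗[k] D)).comp α := by
    apply CoalgHom.coe_linearMap_injective
    ext a b d
    simp [α, smul_smul]
  have h2 : (snd k A B).comp (fst k (A ⊗[k] B) D) =
      ((fst k B D).comp (snd k A (B ⊗[k] D))).comp α := by
    apply CoalgHom.coe_linearMap_injective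
    ext a b d
    simp [α, smul_smul, mul_comm]
  have h3 : snd k (A ⊗[k] B) D = ((snd k B D).comp (snd k A (B ⊗[k] D))).comp α := by
    apply CoalgHom.coe_linearMap_injective
    ext a b d
    simp [α, smul_smul, mul_comm]
  have h : pointOp m (toConv ((snd k A B).comp (fst k (A ⊗[k] B) D)))
      (toConv (snd k (A ⊗[k] B) D)) = toConv ((m.comp (snd k A (B ⊗[k] D))).comp α) := by
    apply WithConv.ext
    change m.comp (pair _ _) = _
    rw [h2]
    conv_lhs => rw [h3]
    rw [← pair_comp, ← pair_comp, pair_fst_snd, CoalgHom.id_comp]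
    rfl
  rw [h, h1]
  change (n.comp (pair _ _)) _ = _
  rw [ofConv_toConv, ofConv_toConv, ← pair_comp]
  exact pointOp_fst_snd_apply n (CoalgHom.id k A) m a (b ⊗ₜ d)

theorem eq_of_eq_on_projections {Z : Type*} [AddCommGroup Z] [Module k Z] [Coalgebra k Z]
    [IsCocomm k A] [IsCocomm k B] [IsCocomm k D]
    (p q : (A ⊗[k] B) ⊗[k] D →ₗc[k] Z)
    (h : ∀ a b d, p ((a ⊗ₜ b) ⊗ₜ d) = q ((a ⊗ₜ b) ⊗ₜ d)) : p = q := by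
  apply CoalgHom.coe_linearMap_injective
  ext a b d
  exact h a b d

theorem pointComp_triple_fst (f : WithConv (C →ₗc[k] A)) (g : WithConv (C →ₗc[k] B))
    (h : WithConv (C →ₗc[k] D)) :
    pointComp (toConv ((fst k A B).comp (fst k (A ⊗[k] B) D)))
      (pair (pair f.ofConv g.ofConv) h.ofConv) = f := by
  apply WithConv.ext
  change ((fst k A B).comp (fst k (A ⊗[k] B) D)).comp _ = _
  rw [CoalgHom.comp_assoc, fst_comp_pair, fst_comp_pair]

theorem pointComp_triple_snd (f : WithConv (C →ₗc[k] A)) (g : WithConv (C →ₗc[k] B))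
    (h : WithConv (C →ₗc[k] D)) :
    pointComp (toConv ((snd k A B).comp (fst k (A ⊗[k] B) D)))
      (pair (pair f.ofConv g.ofConv) h.ofConv) = g := by
  apply WithConv.ext
  change ((snd k A B).comp (fst k (A ⊗[k] B) D)).comp _ = _
  rw [CoalgHom.comp_assoc, fst_comp_pair, snd_comp_pair]

theorem pointComp_triple_thd (f : WithConv (C →ₗc[k] A)) (g : WithConv (C →ₗc[k] B))
    (h : WithConv (C →ₗc[k] D)) :
    pointComp (toConv (snd k (A ⊗[k] B) D))
      (pair (pair f.ofConv g.ofConv) h.ofConv) = h := by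
  apply WithConv.ext
  exact snd_comp_pair _ _

/-- A Yoneda argument: the hypothesis is the identity at the universal point of `(A ⊗ B) ⊗ D`, and
restricting along the map with components `x`, `y`, `z` gives the general case. -/
theorem pointOp_assoc [IsCocomm k A] [IsCocomm k B] [IsCocomm k D]
    (m : A ⊗[k] B →ₗc[k] E) (n : E ⊗[k] D →ₗc[k] F)
    (m' : B ⊗[k] D →ₗc[k] G) (n' : A ⊗[k] G →ₗc[k] F)
    (h : ∀ a b d, n (m (a ⊗ₜ b) ⊗ₜ d) = n' (a ⊗ₜ m' (b ⊗ₜ d)))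
    (x : WithConv (C →ₗc[k] A)) (y : WithConv (C →ₗc[k] B)) (z : WithConv (C →ₗc[k] D)) :
    pointOp n (pointOp m x y) z = pointOp n' x (pointOp m' y z) := by
  have key := congrArg (fun p => pointComp p (pair (pair x.ofConv y.ofConv) z.ofConv))
    (WithConv.ext (eq_of_eq_on_projections _ _ fun a b d =>
      (pointOp_pointOp_left_apply m n a b d).trans
        ((h a b d).trans (pointOp_pointOp_right_apply m' n' a b d).symm)))
  simpa only [pointOp_comp, pointComp_triple_fst, pointComp_triple_snd,
    pointComp_triple_thd] using key

theorem pair_one_left {H : Type*} [Ring H] [Bialgebra k H] (g : WithConv (C →ₗc[k] B)) (c : C) :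
    pair (1 : WithConv (C →ₗc[k] H)).ofConv g.ofConv c = (1 : H) ⊗ₜ g.ofConv c := by
  have h : TensorProduct.map ((1 : WithConv (C →ₗc[k] H)).ofConv : C →ₗ[k] H)
      (g.ofConv : C →ₗ[k] B) = TensorProduct.map (Algebra.linearMap k H) (g.ofConv : C →ₗ[k] B) ∘ₗ
        LinearMap.rTensor C counit := by
    ext; rfl
  rw [pair_apply, h, LinearMap.comp_apply, rTensor_counit_comul]
  simp

theorem pair_one_right {H : Type*} [Ring H] [Bialgebra k H] (f : WithConv (C →ₗc[k] A)) (c : C) :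
    pair f.ofConv (1 : WithConv (C →ₗc[k] H)).ofConv c = f.ofConv c ⊗ₜ (1 : H) := by
  have h : TensorProduct.map (f.ofConv : C →ₗ[k] A)
      ((1 : WithConv (C →ₗc[k] H)).ofConv : C →ₗ[k] H) =
      TensorProduct.map (f.ofConv : C →ₗ[k] A) (Algebra.linearMap k H) ∘ₗ
        LinearMap.lTensor C counit := by
    ext; rfl
  rw [pair_apply, h, LinearMap.comp_apply, lTensor_counit_comul]
  simp

end PointwiseOperations

/-! ### Hopf structures from identities between points -/

section HopfStructure

variable {k K : Type*} [Field k] [Ring K] [HopfAlgebra k K] [IsCocomm k K]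

/-- A Hopf algebra structure on the coalgebra of a bialgebra, with the same unit, from identities
between points. -/
noncomputable def HopfStructure.ofPoints (m : K ⊗[k] K →ₗc[k] K) (T : K →ₗc[k] K)
    (assoc : ∀ f g h : WithConv ((K ⊗[k] K) ⊗[k] K →ₗc[k] K),
      pointOp m (pointOp m f g) h = pointOp m f (pointOp m g h))
    (one_op : ∀ f : WithConv (K →ₗc[k] K), pointOp m 1 f = f)
    (op_one : ∀ f : WithConv (K →ₗc[k] K), pointOp m f 1 = f)
    (inv_op : pointOp m (toConv T) (toConv (CoalgHom.id k K)) = 1)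
    (op_inv : pointOp m (toConv (CoalgHom.id k K)) (toConv T) = 1) : HopfStructure k K where
  mul := TensorProduct.curry (m : K ⊗[k] K →ₗ[k] K)
  one := 1
  antipode := T
  mul_assoc a b c := by
    refine (pointOp_pointOp_left_apply m m a b c).symm.trans (Eq.trans ?_
      (pointOp_pointOp_right_apply m m a b c))
    rw [assoc]
  one_mul a := by
    have h := CoalgHom.congr_fun (congrArg ofConv (one_op (toConv (CoalgHom.id k K)))) a
    exact (congrArg m (pair_one_left (H := K) (toConv (CoalgHom.id k K)) a)).symm.trans h
  mul_one a := by
    have h := CoalgHom.congr_fun (congrArg ofConv (op_one (toConv (CoalgHom.id k K)))) a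
    exact (congrArg m (pair_one_right (H := K) (toConv (CoalgHom.id k K)) a)).symm.trans h
  comul_mul := comul_apply_tmul m
  comul_one := Bialgebra.comul_one
  counit_mul := counit_apply_tmul m
  counit_one := Bialgebra.counit_one
  antipode_mul a := by
    have h := CoalgHom.congr_fun (congrArg ofConv inv_op) a
    have h' : TensorProduct.lift (TensorProduct.curry (m : K ⊗[k] K →ₗ[k] K)) = m := by ext; rfl
    rw [h', ← Algebra.algebraMap_eq_smul_one]
    exact h
  mul_antipode a := by
    have h := CoalgHom.congr_fun (congrArg ofConv op_inv) a
    have h' : TensorProduct.lift (TensorProduct.curry (m : K ⊗[k] K →ₗ[k] K)) = m := by ext; rfl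
    rw [h', ← Algebra.algebraMap_eq_smul_one]
    exact h

end HopfStructure

/-! ### Module bialgebras on points -/

section ModuleBialgebra

variable {k H K C : Type*} [Field k] [Ring H] [HopfAlgebra k H]
  [Ring K] [HopfAlgebra k K] [AddCommGroup C] [Module k C] [Coalgebra k C]
  [IsCocomm k C] {act : H →ₗ[k] K →ₗ[k] K}

/-- The action on a module bialgebra, as a homomorphism of coalgebras. -/
noncomputable def IsModuleBialgebra.actHom (h : IsModuleBialgebra act) : H ⊗[k] K →ₗc[k] K :=
  liftCoalgHom act h.comul_act h.counit_act

theorem IsModuleBialgebra.one_pointOp (h : IsModuleBialgebra act) (x : WithConv (C →ₗc[k] K)) :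
    pointOp h.actHom 1 x = x := by
  apply WithConv.ext
  ext c
  exact (congrArg h.actHom (pair_one_left x c)).trans (h.one_act _)

theorem IsModuleBialgebra.pointOp_one (h : IsModuleBialgebra act) (f : WithConv (C →ₗc[k] H)) :
    pointOp h.actHom f 1 = 1 := by
  apply WithConv.ext
  ext c
  refine (congrArg h.actHom (pair_one_right f c)).trans ((h.act_one _).trans ?_)
  rw [CoalgHomClass.counit_comp_apply, one_apply, Algebra.algebraMap_eq_smul_one]

variable [IsCocomm k H] [IsCocomm k K]

/-- The acting point occurs twice on the right, so `pointOp_assoc` does not apply. At the universal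
point of `(H ⊗ K) ⊗ K`, the counits in the projections remove the superfluous legs and leave the
axiom `act_mul`. -/
theorem IsModuleBialgebra.pointOp_mul (h : IsModuleBialgebra act) (f : WithConv (C →ₗc[k] H))
    (x y : WithConv (C →ₗc[k] K)) :
    pointOp h.actHom f (x * y) = pointOp h.actHom f x * pointOp h.actHom f y := by
  let p₁ := toConv ((fst k H K).comp (fst k (H ⊗[k] K) K))
  let p₂ := toConv ((snd k H K).comp (fst k (H ⊗[k] K) K))
  let p₃ := toConv (snd k (H ⊗[k] K) K)
  have h₂ : pointOp h.actHom p₁ p₂ = toConv (h.actHom.comp (fst k (H ⊗[k] K) K)) := by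
    apply WithConv.ext
    change h.actHom.comp (pair _ _) = _
    rw [← pair_comp, pair_fst_snd, CoalgHom.id_comp]
  have h₃ (a : H) (b c : K) :
      (pointOp h.actHom p₁ p₃).ofConv ((a ⊗ₜ b) ⊗ₜ c) = (counit b : k) • act a c :=
    (pointOp_fst_snd_apply h.actHom (fst k H K) (CoalgHom.id k K) (a ⊗ₜ b) c).trans
      (by
        change act ((counit b : k) • a) c = _
        rw [map_smul, LinearMap.smul_apply])
  have h₄ (a : H) (b c : K) :
      (pointOp h.actHom p₁ p₂ * pointOp h.actHom p₁ p₃).ofConv ((a ⊗ₜ b) ⊗ₜ c) =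
        conv (act.flip b) (act.flip c) a := by
    rw [h₂]
    change LinearMap.mul' k K (TensorProduct.map
      ((h.actHom : H ⊗[k] K →ₗ[k] K) ∘ₗ (fst k (H ⊗[k] K) K : (H ⊗[k] K) ⊗[k] K →ₗ[k] H ⊗[k] K))
      ((pointOp h.actHom p₁ p₃).ofConv : (H ⊗[k] K) ⊗[k] K →ₗ[k] K)
      (comul ((a ⊗ₜ[k] b) ⊗ₜ[k] c))) = _
    rw [map_fst_comul_tmul]
    have e : ((pointOp h.actHom p₁ p₃).ofConv : (H ⊗[k] K) ⊗[k] K →ₗ[k] K) ∘ₗ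
        (TensorProduct.mk k (H ⊗[k] K) K).flip c =
        act.flip c ∘ₗ (fst k H K : H ⊗[k] K →ₗ[k] H) := by
      ext a b
      refine (h₃ a b c).trans ?_
      simp
    rw [e, map_comul_tmul_fst]
    rfl
  have key := congrArg (fun p => pointComp p (pair (pair f.ofConv x.ofConv) y.ofConv))
    (WithConv.ext (eq_of_eq_on_projections (pointOp h.actHom p₁ (p₂ * p₃)).ofConv _ fun a b c =>
      ((pointOp_pointOp_right_apply (mulCoalgHom k K) h.actHom a b c).trans
        (h.act_mul a b c)).trans (h₄ a b c).symm))
  change pointComp (pointOp h.actHom p₁ (pointOp (mulCoalgHom k K) p₂ p₃)) _ =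
    pointComp (pointOp (mulCoalgHom k K) (pointOp h.actHom p₁ p₂) (pointOp h.actHom p₁ p₃)) _
    at key
  simp only [pointOp_comp, p₁, p₂, p₃, pointComp_triple_fst, pointComp_triple_snd,
    pointComp_triple_thd] at key
  exact key

theorem IsModuleBialgebra.mul_pointOp (h : IsModuleBialgebra act) (f g : WithConv (C →ₗc[k] H))
    (x : WithConv (C →ₗc[k] K)) :
    pointOp h.actHom (f * g) x = pointOp h.actHom f (pointOp h.actHom g x) :=
  pointOp_assoc (mulCoalgHom k H) h.actHom h.actHom h.actHom (fun a b d => h.mul_act a b d) f g x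

end ModuleBialgebra

/-! ### The second Hopf structure of a relative Rota–Baxter operator -/

section RelativeRotaBaxter

variable {k H K : Type*} [Field k] [Ring H] [HopfAlgebra k H]
  [Ring K] [HopfAlgebra k K] [IsCocomm k K]
  {act : H →ₗ[k] K →ₗ[k] K} {τ : K →ₗc[k] H}

/-- The product `a ∘ b = a₁ (τ(a₂) ⇀ b)` of a relative Rota-Baxter operator, as a homomorphism
of coalgebras. -/
noncomputable def IsRelativeRotaBaxter.circHom (h : IsRelativeRotaBaxter act τ) :
    K ⊗[k] K →ₗc[k] K :=
  (toConv (fst k K K) *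
    pointOp h.moduleBialgebra.actHom (toConv (τ.comp (fst k K K))) (toConv (snd k K K))).ofConv

theorem IsRelativeRotaBaxter.circHom_tmul (h : IsRelativeRotaBaxter act τ) (a b : K) :
    h.circHom (a ⊗ₜ b) = conv LinearMap.id (act.flip b ∘ₗ (τ : K →ₗ[k] H)) a := by
  change LinearMap.mul' k K (TensorProduct.map
    (LinearMap.id ∘ₗ (fst k K K : K ⊗[k] K →ₗ[k] K))
    ((pointOp h.moduleBialgebra.actHom (toConv (τ.comp (fst k K K)))
      (toConv (snd k K K))).ofConv : K ⊗[k] K →ₗ[k] K) (comul (a ⊗ₜ[k] b))) = _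
  rw [map_fst_comul_tmul]
  have e : ((pointOp h.moduleBialgebra.actHom (toConv (τ.comp (fst k K K)))
      (toConv (snd k K K))).ofConv : K ⊗[k] K →ₗ[k] K) ∘ₗ
      (TensorProduct.mk k K K).flip b = act.flip b ∘ₗ (τ : K →ₗ[k] H) := by
    ext a
    exact pointOp_fst_snd_apply h.moduleBialgebra.actHom τ (CoalgHom.id k K) a b
  rw [e]
  rfl

variable {C : Type*} [AddCommGroup C] [Module k C] [Coalgebra k C] [IsCocomm k C]

theorem IsRelativeRotaBaxter.pointOp_circHom (h : IsRelativeRotaBaxter act τ)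
    (f g : WithConv (C →ₗc[k] K)) :
    pointOp h.circHom f g = f * pointOp h.moduleBialgebra.actHom (pointMap τ f) g := by
  have key : pointOp h.circHom f g = pointComp (pointOp (mulCoalgHom k K) (toConv (fst k K K))
    (pointOp h.moduleBialgebra.actHom (toConv (τ.comp (fst k K K)))
      (toConv (snd k K K)))) (pair f.ofConv g.ofConv) := rfl
  have h₁ : pointComp (toConv (fst k K K)) (pair f.ofConv g.ofConv) = f :=
    WithConv.ext (fst_comp_pair _ _)
  have h₂ : pointComp (toConv (snd k K K)) (pair f.ofConv g.ofConv) = g :=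
    WithConv.ext (snd_comp_pair _ _)
  have h₃ : pointComp (toConv (τ.comp (fst k K K))) (pair f.ofConv g.ofConv) = pointMap τ f := by
    apply WithConv.ext
    change (τ.comp (fst k K K)).comp _ = τ.comp f.ofConv
    rw [CoalgHom.comp_assoc, fst_comp_pair]
  rw [key, pointOp_comp, pointOp_comp, h₁, h₂, h₃]
  rfl

theorem IsRelativeRotaBaxter.pointMap_mul (h : IsRelativeRotaBaxter act τ)
    (f g : WithConv (C →ₗc[k] K)) :
    pointMap τ f * pointMap τ g = pointMap τ (pointOp h.circHom f g) := by
  have key : (mulCoalgHom k H).comp (Coalgebra.TensorProduct.map τ τ) = τ.comp h.circHom := by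
    apply CoalgHom.coe_linearMap_injective
    ext a b
    exact (h.mul_eq a b).trans (congrArg τ (h.circHom_tmul a b).symm)
  apply WithConv.ext
  change (mulCoalgHom k H).comp (pair (τ.comp f.ofConv) (τ.comp g.ofConv)) =
    τ.comp (h.circHom.comp (pair f.ofConv g.ofConv))
  rw [← map_comp_pair, ← CoalgHom.comp_assoc, key, CoalgHom.comp_assoc]

variable [IsCocomm k H]

/-- Unitality of `τ` is not assumed: since `1 ∘ 1 = 1`, its value at `1` is an idempotent in a
group. -/
theorem IsRelativeRotaBaxter.pointMap_one (h : IsRelativeRotaBaxter act τ) :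
    pointMap τ (1 : WithConv (C →ₗc[k] K)) = 1 := by
  have key := h.pointMap_mul (1 : WithConv (C →ₗc[k] K)) 1
  rw [h.pointOp_circHom, h.moduleBialgebra.pointOp_one, mul_one] at key
  exact mul_eq_left.mp key

/-- The inverse of a point for the product of a relative Rota-Baxter operator. -/
noncomputable def IsRelativeRotaBaxter.circInv (h : IsRelativeRotaBaxter act τ)
    (x : WithConv (C →ₗc[k] K)) : WithConv (C →ₗc[k] K) :=
  pointOp h.moduleBialgebra.actHom (pointMap τ x)⁻¹ x⁻¹

theorem IsRelativeRotaBaxter.pointOp_circInv (h : IsRelativeRotaBaxter act τ)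
    (x : WithConv (C →ₗc[k] K)) : pointOp h.circHom x (h.circInv x) = 1 := by
  rw [h.pointOp_circHom, circInv, ← h.moduleBialgebra.mul_pointOp, mul_inv_cancel,
    h.moduleBialgebra.one_pointOp, mul_inv_cancel]

theorem IsRelativeRotaBaxter.pointMap_circInv (h : IsRelativeRotaBaxter act τ)
    (x : WithConv (C →ₗc[k] K)) : pointMap τ (h.circInv x) = (pointMap τ x)⁻¹ := by
  refine (inv_eq_of_mul_eq_one_right ?_).symm
  rw [h.pointMap_mul, h.pointOp_circInv, h.pointMap_one]

/-- As `τ` sends the candidate inverse to `τ(x)⁻¹`, the product is `τ(x)⁻¹ ⇀ (x⁻¹x)`. -/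
theorem IsRelativeRotaBaxter.circInv_pointOp (h : IsRelativeRotaBaxter act τ)
    (x : WithConv (C →ₗc[k] K)) : pointOp h.circHom (h.circInv x) x = 1 := by
  rw [h.pointOp_circHom, h.pointMap_circInv, circInv, ← h.moduleBialgebra.pointOp_mul,
    inv_mul_cancel, h.moduleBialgebra.pointOp_one]

/-- Both sides expand to `x · (τ(x) ⇀ y) · (τ(x)τ(y) ⇀ z)`. -/
theorem IsRelativeRotaBaxter.pointOp_circHom_assoc (h : IsRelativeRotaBaxter act τ)
    (x y z : WithConv (C →ₗc[k] K)) :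
    pointOp h.circHom (pointOp h.circHom x y) z = pointOp h.circHom x (pointOp h.circHom y z) := by
  rw [h.pointOp_circHom (pointOp h.circHom x y), ← h.pointMap_mul, h.pointOp_circHom x,
    h.pointOp_circHom x, h.pointOp_circHom y, h.moduleBialgebra.pointOp_mul,
    h.moduleBialgebra.mul_pointOp, mul_assoc]

/-- The second Hopf algebra structure defined by a relative Rota-Baxter operator. -/
noncomputable def IsRelativeRotaBaxter.hopfStructure (h : IsRelativeRotaBaxter act τ) :
    HopfStructure k K :=
  HopfStructure.ofPoints h.circHom (h.circInv (toConv (CoalgHom.id k K))).ofConv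
    h.pointOp_circHom_assoc
    (fun x => by
      rw [h.pointOp_circHom, h.pointMap_one, one_mul, h.moduleBialgebra.one_pointOp])
    (fun x => by
      rw [h.pointOp_circHom, h.moduleBialgebra.pointOp_one, mul_one])
    (h.circInv_pointOp _)
    (h.pointOp_circInv _)

end RelativeRotaBaxter

/-! ### Convolution identities with the antipode -/

section Conv

variable {k C D A : Type*} [Field k] [AddCommGroup C] [Module k C] [Coalgebra k C]
  [AddCommGroup D] [Module k D] [Coalgebra k D] [Ring A] [Algebra k A]

theorem toConv_conv (f g : C →ₗ[k] A) : toConv (conv f g) = toConv f * toConv g := rfl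

theorem conv_assoc (f g h : C →ₗ[k] A) : conv (conv f g) h = conv f (conv g h) :=
  toConv_injective (mul_assoc (toConv f) (toConv g) (toConv h))

theorem conv_comp_coalgHom (f g : C →ₗ[k] A) (φ : D →ₗc[k] C) :
    conv f g ∘ₗ (φ : D →ₗ[k] C) = conv (f ∘ₗ (φ : D →ₗ[k] C)) (g ∘ₗ (φ : D →ₗ[k] C)) :=
  LinearMap.convMul_comp_coalgHom_distrib (toConv f) (toConv g) φ

variable {H : Type*} [Ring H] [HopfAlgebra k H]

theorem conv_antipode_conv_id (f : H →ₗ[k] H) :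
    conv (HopfAlgebra.antipode k) (conv LinearMap.id f) = f := by
  apply toConv_injective
  rw [toConv_conv, toConv_conv, ← mul_assoc, LinearMap.antipode_mul_id, one_mul]

theorem conv_id_conv_antipode (f : H →ₗ[k] H) :
    conv LinearMap.id (conv (HopfAlgebra.antipode k) f) = f := by
  apply toConv_injective
  rw [toConv_conv, toConv_conv, ← mul_assoc, LinearMap.id_mul_antipode, one_mul]

end Conv

/-! ### Hopf braces and their actions -/

section HopfBrace

variable {k H K : Type*} [Field k] [Ring H] [HopfAlgebra k H] [Ring K] [HopfAlgebra k K]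
  {act : H →ₗ[k] K →ₗ[k] K}

/-- A second Hopf algebra structure whose product is `a ∘ b = a₁ (φ(a₂) ⇀ b)`, for an action by
which `K` is a module algebra, is part of a Hopf brace. -/
noncomputable def HopfBrace.ofAction (s : HopfStructure k K) (φ : K →ₗc[k] H)
    (hact : IsModuleAlgebra act)
    (hmul : ∀ a b, s.mul a b = conv LinearMap.id (act.flip b ∘ₗ (φ : K →ₗ[k] H)) a) :
    HopfBrace k K where
  toHopfStructure := s
  compat a b c := by
    have hflip (b : K) : s.mul.flip b = conv LinearMap.id (act.flip b ∘ₗ (φ : K →ₗ[k] H)) :=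
      LinearMap.ext fun a => hmul a b
    have hmul' : act.flip (b * c) = conv (act.flip b) (act.flip c) :=
      LinearMap.ext fun h => hact.act_mul h b c
    -- With `α_b(a) = φ(a) ⇀ b`, the claim is `id * (α_b * α_c) = (id * α_b) * S * (id * α_c)`,
    -- where the inner `S * id` cancels.
    rw [hmul, hmul', conv_comp_coalgHom, hflip, hflip, conv_assoc, conv_antipode_conv_id,
      conv_assoc]

theorem HopfBrace.conv_id_act (G : HopfBrace k K) (a b : K) :
    conv LinearMap.id ((show K →ₗ[k] K →ₗ[k] K from G.act).flip b) a = G.mul a b :=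
  LinearMap.congr_fun (conv_id_conv_antipode (G.mul.flip b)) a

theorem HopfBrace.isRelativeRotaBaxter_id (G : HopfBrace k K) (h : IsModuleBialgebra G.act) :
    IsRelativeRotaBaxter G.act (G.idEquiv : K →ₗc[k] G.Carrier) where
  moduleBialgebra := h
  mul_eq a b := (G.conv_id_act a b).symm

theorem HopfBrace.isBijectiveOneCocycle_id (G : HopfBrace k K) (h : IsModuleBialgebra G.act) :
    IsBijectiveOneCocycle G.act G.idEquiv.symm where
  moduleAlgebra := h.toIsModuleAlgebra
  map_mul a b := (G.conv_id_act a b).symm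

variable [IsCocomm k K]

/-- The action of a Hopf brace on itself, as a homomorphism of coalgebras. -/
noncomputable def HopfBrace.actCoalgHom (G : HopfBrace k K) : K ⊗[k] K →ₗc[k] K :=
  (toConv ((antipodeCoalgHom k K).comp (fst k K K)) *
    toConv (liftCoalgHom G.mul G.comul_mul G.counit_mul)).ofConv

theorem HopfBrace.actCoalgHom_tmul (G : HopfBrace k K) (a b : K) :
    G.actCoalgHom (a ⊗ₜ b) = G.act a b := by
  change LinearMap.mul' k K (TensorProduct.map
    (HopfAlgebra.antipode k ∘ₗ (fst k K K : K ⊗[k] K →ₗ[k] K))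
    (TensorProduct.lift G.mul) (comul (a ⊗ₜ[k] b))) = _
  rw [map_fst_comul_tmul]
  rfl

/-- In the cocommutative case the brace action is a product of two points of `K` over `K ⊗ K`, hence
a coalgebra map for every brace. -/
theorem HopfBrace.comul_act (G : HopfBrace k K) (a b : K) :
    (comul (G.act a b) : K ⊗[k] K) =
      TensorProduct.map₂ (show K →ₗ[k] K →ₗ[k] K from G.act) (show K →ₗ[k] K →ₗ[k] K from G.act)
        (comul a) (comul b) := by
  have h : TensorProduct.curry (G.actCoalgHom : K ⊗[k] K →ₗ[k] K) =
      (show K →ₗ[k] K →ₗ[k] K from G.act) := by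
    ext a b
    exact G.actCoalgHom_tmul a b
  rw [← G.actCoalgHom_tmul, comul_apply_tmul, h]

theorem HopfBrace.counit_act (G : HopfBrace k K) (a b : K) :
    (counit (G.act a b) : k) = counit a * counit b := by
  rw [← G.actCoalgHom_tmul, counit_apply_tmul]

/-- Convolving `a ∘ b = a₁(φ(a₂) ⇀ b)` with the antipode shows that the brace action is `φ(a) ⇀ b`,
so the module algebra axioms pull back along `φ`. Compatibility of the original action with `Δ` is
not needed, which is what lets 1-cocycles be treated too. -/
theorem HopfBrace.isModuleBialgebra_act (G : HopfBrace k K) (φ : K →ₗc[k] H)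
    (hact : IsModuleAlgebra act) (hφ : ∀ a b, φ (G.mul a b) = φ a * φ b) (hφ1 : φ G.one = 1)
    (hmul : ∀ a b, G.mul a b = conv LinearMap.id (act.flip b ∘ₗ (φ : K →ₗ[k] H)) a) :
    IsModuleBialgebra G.act := by
  have hflip (b : K) : (show K →ₗ[k] K →ₗ[k] K from G.act).flip b =
      act.flip b ∘ₗ (φ : K →ₗ[k] H) := by
    have h : G.mul.flip b = conv LinearMap.id (act.flip b ∘ₗ (φ : K →ₗ[k] H)) :=
      LinearMap.ext fun a => hmul a b
    have h' := conv_antipode_conv_id (act.flip b ∘ₗ (φ : K →ₗ[k] H))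
    rw [← h] at h'
    exact h'
  have hG (a b : K) : G.act a b = act (φ a) b := LinearMap.congr_fun (hflip b) a
  have hmul_act (g h x : K) : G.act (G.mul g h) x = G.act g (show K from G.act h x) := by
    rw [hG, hG, hG, hφ, hact.mul_act]
  have hact_one (h : K) : G.act h 1 = (counit h : k) • (1 : K) := by
    rw [hG, hact.act_one, CoalgHomClass.counit_comp_apply]
  refine
    { one_act := fun x => ?_
      mul_act := fun g h x => ?_
      act_mul := fun h x y => ?_
      act_one := fun h => ?_
      comul_act := G.comul_act
      counit_act := G.counit_act }
  · exact (hG G.one x).trans (by rw [hφ1, hact.one_act])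
  · exact hmul_act g h x
  · refine (hG h (x * y)).trans ((hact.act_mul _ _ _).trans ?_)
    refine (LinearMap.congr_fun (conv_comp_coalgHom (act.flip x) (act.flip y) φ) h).trans ?_
    rw [← hflip, ← hflip]
    rfl
  · exact hact_one h

end HopfBrace

/-! ### Transport of structure along a bijective 1-cocycle -/

section Cocycle

variable {k H K : Type*} [Field k] [Ring H] [HopfAlgebra k H]
  [Ring K] [HopfAlgebra k K] {act : H →ₗ[k] K →ₗ[k] K} {π : H ≃ₗc[k] K}

/-- The element `π 1` is grouplike, hence has its antipode as left inverse, and the cocycle identity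
at `1, 1` makes it idempotent. -/
theorem IsBijectiveOneCocycle.map_one (h : IsBijectiveOneCocycle act π) : π 1 = 1 := by
  have hcomul : (comul (π 1) : K ⊗[k] K) = π 1 ⊗ₜ π 1 := by
    rw [← CoalgHomClass.map_comp_comul_apply, Bialgebra.comul_one,
      Algebra.TensorProduct.one_def, TensorProduct.map_tmul]
    rfl
  have hinv : HopfAlgebra.antipode k (π 1) * π 1 = 1 := by
    have := HopfAlgebra.mul_antipode_rTensor_comul_apply (R := k) (π 1)
    rwa [hcomul, LinearMap.rTensor_tmul, LinearMap.mul'_apply,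
      CoalgHomClass.counit_comp_apply, Bialgebra.counit_one, (algebraMap k K).map_one] at this
  have hidem : π 1 = π 1 * π 1 := by
    have := h.map_mul 1 1
    rw [mul_one, conv, LinearMap.comp_apply, LinearMap.comp_apply, Bialgebra.comul_one,
      Algebra.TensorProduct.one_def, TensorProduct.map_tmul, LinearMap.mul'_apply,
      LinearMap.flip_apply, h.moduleAlgebra.one_act] at this
    exact this
  calc π 1 = HopfAlgebra.antipode k (π 1) * π 1 * π 1 := by rw [hinv, one_mul]
    _ = 1 := by rw [mul_assoc, ← hidem, hinv]

variable (π) in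
/-- The product transported along a coalgebra isomorphism, as a homomorphism of coalgebras. -/
noncomputable def transportMul : K ⊗[k] K →ₗc[k] K :=
  (π : H →ₗc[k] K).comp ((mulCoalgHom k H).comp
    (Coalgebra.TensorProduct.map (π.symm : K →ₗc[k] H) (π.symm : K →ₗc[k] H)))

section Transport

variable {C : Type*} [AddCommGroup C] [Module k C] [Coalgebra k C]

theorem pointMap_symm_pointMap (f : WithConv (C →ₗc[k] H)) :
    pointMap (π.symm : K →ₗc[k] H) (pointMap (π : H →ₗc[k] K) f) = f := by
  apply WithConv.ext
  ext c
  exact π.symm_apply_apply (f.ofConv c)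

theorem pointMap_pointMap_symm (f : WithConv (C →ₗc[k] K)) :
    pointMap (π : H →ₗc[k] K) (pointMap (π.symm : K →ₗc[k] H) f) = f := by
  apply WithConv.ext
  ext c
  exact π.apply_symm_apply (f.ofConv c)

theorem IsBijectiveOneCocycle.pointMap_one (h : IsBijectiveOneCocycle act π) :
    pointMap (π : H →ₗc[k] K) (1 : WithConv (C →ₗc[k] H)) = 1 := by
  apply WithConv.ext
  ext c
  change π (algebraMap k H (counit c)) = algebraMap k K (counit c)
  rw [Algebra.algebraMap_eq_smul_one, Algebra.algebraMap_eq_smul_one, map_smul,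
    IsBijectiveOneCocycle.map_one h]

theorem IsBijectiveOneCocycle.pointMap_symm_one (h : IsBijectiveOneCocycle act π) :
    pointMap (π.symm : K →ₗc[k] H) (1 : WithConv (C →ₗc[k] K)) = 1 := by
  rw [← h.pointMap_one, pointMap_symm_pointMap]

variable [IsCocomm k C]

theorem pointOp_transportMul (f g : WithConv (C →ₗc[k] K)) :
    pointOp (transportMul π) f g = pointMap (π : H →ₗc[k] K)
      (pointMap (π.symm : K →ₗc[k] H) f * pointMap (π.symm : K →ₗc[k] H) g) := by
  apply WithConv.ext
  change ((π : H →ₗc[k] K).comp ((mulCoalgHom k H).comp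
    (Coalgebra.TensorProduct.map (π.symm : K →ₗc[k] H) (π.symm : K →ₗc[k] H)))).comp
      (pair _ _) = _
  rw [CoalgHom.comp_assoc, CoalgHom.comp_assoc, map_comp_pair]
  rfl

theorem transportMul_assoc (x y z : WithConv (C →ₗc[k] K)) :
    pointOp (transportMul π) (pointOp (transportMul π) x y) z =
      pointOp (transportMul π) x (pointOp (transportMul π) y z) := by
  simp only [pointOp_transportMul, pointMap_symm_pointMap, mul_assoc]

end Transport

variable [IsCocomm k H] [IsCocomm k K]

/-- The transport of the Hopf algebra structure of `H` along a bijective 1-cocycle `H → K`. -/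
noncomputable def IsBijectiveOneCocycle.hopfStructure (h : IsBijectiveOneCocycle act π) :
    HopfStructure k K :=
  HopfStructure.ofPoints (transportMul π)
    (pointMap (π : H →ₗc[k] K)
      (pointMap (π.symm : K →ₗc[k] H) (toConv (CoalgHom.id k K)))⁻¹).ofConv
    transportMul_assoc
    (fun x => by
      rw [pointOp_transportMul, h.pointMap_symm_one, one_mul, pointMap_pointMap_symm])
    (fun x => by
      rw [pointOp_transportMul, h.pointMap_symm_one, mul_one, pointMap_pointMap_symm])
    (by rw [pointOp_transportMul, toConv_ofConv, pointMap_symm_pointMap, inv_mul_cancel,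
      h.pointMap_one])
    (by rw [pointOp_transportMul, toConv_ofConv, pointMap_symm_pointMap, mul_inv_cancel,
      h.pointMap_one])

end Cocycle

/-! ### The adjoint action and Rota–Baxter operators -/

section Adjoint

variable {k H : Type*} [Field k] [Ring H] [HopfAlgebra k H]

variable (k) in
/-- The linear map `c ↦ ε(c) y`. -/
noncomputable def counitSMul (y : H) : H →ₗ[k] H := LinearMap.toSpanSingleton k H y ∘ₗ counit

theorem counitSMul_comp_coalgHom (y : H) (B : H →ₗc[k] H) :
    counitSMul k y ∘ₗ (B : H →ₗ[k] H) = counitSMul k y := by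
  ext x
  simp [counitSMul]

theorem conv_counitSMul (f : H →ₗ[k] H) (y : H) :
    conv f (counitSMul k y) = LinearMap.mulRight k y ∘ₗ f := by
  have h : TensorProduct.map f (counitSMul k y) =
      TensorProduct.map f (LinearMap.toSpanSingleton k H y) ∘ₗ LinearMap.lTensor H counit := by
    ext; rfl
  ext x
  rw [conv, h, LinearMap.comp_apply, LinearMap.comp_apply, LinearMap.comp_apply,
    lTensor_counit_comul]
  simp

theorem conv_counitSMul_counitSMul (x y : H) :
    conv (counitSMul k x) (counitSMul k y) = counitSMul k (x * y) := by
  rw [conv_counitSMul]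
  ext a
  simp [counitSMul]

variable (k H) in
/-- The linear map sending `a ⊗ b` to the endomorphism `x ↦ a x b`. -/
noncomputable def sandwich : H ⊗[k] H →ₗ[k] H →ₗ[k] H :=
  TensorProduct.lift ((LinearMap.llcomp k H H H ∘ₗ LinearMap.mul k H).compl₂
    (LinearMap.mul k H).flip)

@[simp]
theorem sandwich_tmul (a b x : H) : sandwich k H (a ⊗ₜ b) x = a * (x * b) := rfl

variable (k H) in
/-- The adjoint action `h ⇀ x = h₁ x S(h₂)` of a Hopf algebra on itself. -/
noncomputable def adjointAct : H →ₗ[k] H →ₗ[k] H :=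
  sandwich k H ∘ₗ LinearMap.lTensor H (HopfAlgebra.antipode k) ∘ₗ comul

/-- Treating `x` as the constant `ε(·)x` makes the adjoint action a triple convolution, so later
identities follow from associativity and antipode cancellation. -/
theorem adjointAct_flip (x : H) : (adjointAct k H).flip x =
    conv (conv LinearMap.id (counitSMul k x)) (HopfAlgebra.antipode k) := by
  have h : LinearMap.flip (sandwich k H ∘ₗ
      LinearMap.lTensor H (HopfAlgebra.antipode k)) x =
      LinearMap.mul' k H ∘ₗ TensorProduct.map (LinearMap.mulRight k x)
        (HopfAlgebra.antipode k) := by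
    ext a b
    simp [mul_assoc]
  rw [conv_counitSMul]
  ext a
  exact LinearMap.congr_fun h (comul a)

theorem isModuleAlgebra_adjointAct : IsModuleAlgebra (adjointAct k H) where
  one_act x := by
    simp [adjointAct, Algebra.TensorProduct.one_def]
  mul_act g h x := by
    -- Multiplicativity holds for arbitrary tensors because `S` reverses products; it is then
    -- applied to `Δ(g)Δ(h)`.
    have key (y z : H ⊗[k] H) :
        sandwich k H (LinearMap.lTensor H (HopfAlgebra.antipode k) (y * z)) x =
        sandwich k H (LinearMap.lTensor H (HopfAlgebra.antipode k) y)
          (sandwich k H (LinearMap.lTensor H (HopfAlgebra.antipode k) z) x) := by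
      induction y with
      | zero => simp
      | add y y' hy hy' => simp only [add_mul, map_add, LinearMap.add_apply, hy, hy']
      | tmul a b =>
        induction z with
        | zero => simp
        | add z z' hz hz' => simp only [mul_add, map_add, LinearMap.add_apply, hz, hz']
        | tmul c d => simp [HopfAlgebra.antipode_mul_antidistrib, mul_assoc]
    simp only [adjointAct, LinearMap.comp_apply, Bialgebra.comul_mul, key]
  act_mul h x y := by
    rw [adjointAct_flip, adjointAct_flip]
    refine LinearMap.congr_fun (f := (adjointAct k H).flip (x * y)) ?_ h
    rw [adjointAct_flip, ← conv_counitSMul_counitSMul]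
    -- The inner `S * id` cancels in `(id * x * S) * (id * y * S)`.
    simp only [conv_assoc, conv_antipode_conv_id]
  act_one h := by
    refine (LinearMap.congr_fun (adjointAct_flip (1 : H)) h).trans ?_
    rw [conv_counitSMul, LinearMap.mulRight_one]
    exact (HopfAlgebra.mul_antipode_lTensor_comul_apply (R := k) h).trans
      (Algebra.algebraMap_eq_smul_one _)

theorem conv_id_adjointAct_flip_comp (B : H →ₗc[k] H) (y : H) :
    conv LinearMap.id ((adjointAct k H).flip y ∘ₗ (B : H →ₗ[k] H)) =
      conv (LinearMap.mulRight k y ∘ₗ conv LinearMap.id (B : H →ₗ[k] H))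
        (HopfAlgebra.antipode k ∘ₗ (B : H →ₗ[k] H)) := by
  rw [adjointAct_flip, conv_comp_coalgHom, conv_comp_coalgHom, counitSMul_comp_coalgHom,
    ← conv_counitSMul, LinearMap.id_comp]
  simp only [conv_assoc]

variable [IsCocomm k H]

variable (k H) in
/-- The adjoint action, as a homomorphism of coalgebras. -/
noncomputable def adjointCoalgHom : H ⊗[k] H →ₗc[k] H :=
  (toConv (mulCoalgHom k H) * toConv ((antipodeCoalgHom k H).comp (fst k H H))).ofConv

theorem adjointCoalgHom_tmul (h x : H) :
    adjointCoalgHom k H (h ⊗ₜ x) = adjointAct k H h x := by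
  change LinearMap.mul' k H (TensorProduct.map (mulCoalgHom k H : H ⊗[k] H →ₗ[k] H)
    (HopfAlgebra.antipode k ∘ₗ (fst k H H : H ⊗[k] H →ₗ[k] H)) (comul (h ⊗ₜ[k] x))) = _
  rw [map_comul_tmul_fst]
  refine Eq.trans ?_ (LinearMap.congr_fun (adjointAct_flip x) h).symm
  rw [conv_counitSMul]
  rfl

theorem isModuleBialgebra_adjointAct : IsModuleBialgebra (adjointAct k H) where
  toIsModuleAlgebra := isModuleAlgebra_adjointAct
  comul_act h x := by
    have e : TensorProduct.curry (adjointCoalgHom k H : H ⊗[k] H →ₗ[k] H) = adjointAct k H := by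
      ext a b
      exact adjointCoalgHom_tmul a b
    rw [← adjointCoalgHom_tmul, comul_apply_tmul, e]
  counit_act h x := by
    rw [← adjointCoalgHom_tmul, counit_apply_tmul]

theorem IsRotaBaxter.isRelativeRotaBaxter {B : H →ₗc[k] H} (hB : IsRotaBaxter B) :
    IsRelativeRotaBaxter (adjointAct k H) B where
  moduleBialgebra := isModuleBialgebra_adjointAct
  mul_eq x y := by
    rw [hB, conv_id_adjointAct_flip_comp]

end Adjoint

/-! ### The three constructions -/

section Braces

variable {k H K : Type*} [Field k] [Ring H] [HopfAlgebra k H] [IsCocomm k H]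
  [Ring K] [HopfAlgebra k K] [IsCocomm k K] {act : H →ₗ[k] K →ₗ[k] K}

theorem IsBijectiveOneCocycle.exists_hopfBrace {π : H ≃ₗc[k] K}
    (h : IsBijectiveOneCocycle act π) :
    ∃ G : HopfBrace k K, (∀ a b, G.mul a b = π (π.symm a * π.symm b)) ∧
      IsRelativeRotaBaxter G.act (G.idEquiv : K →ₗc[k] G.Carrier) := by
  have hmul (a b : K) : h.hopfStructure.mul a b =
      conv LinearMap.id (act.flip b ∘ₗ ((π.symm : K →ₗc[k] H) : K →ₗ[k] H)) a := by
    -- The cocycle identity at `π⁻¹(a)`, `π⁻¹(b)` becomes `a₁(π⁻¹(a₂) ⇀ b)`, since `π⁻¹` preserves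
    -- `Δ`.
    refine (h.map_mul (π.symm a) (π.symm b)).trans ?_
    rw [π.apply_symm_apply]
    refine (LinearMap.congr_fun (conv_comp_coalgHom (π : H →ₗ[k] K) (act.flip b)
      (π.symm : K →ₗc[k] H)) a).trans ?_
    congr 2
    ext x
    exact π.apply_symm_apply x
  let G := HopfBrace.ofAction h.hopfStructure (π.symm : K →ₗc[k] H) h.moduleAlgebra hmul
  refine ⟨G, fun a b => rfl, G.isRelativeRotaBaxter_id (G.isModuleBialgebra_act
    (π.symm : K →ₗc[k] H) h.moduleAlgebra (fun a b => π.symm_apply_apply _) ?_ hmul)⟩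
  exact (congrArg π.symm (IsBijectiveOneCocycle.map_one h)).symm.trans (π.symm_apply_apply 1)

theorem IsRelativeRotaBaxter.exists_hopfBrace {τ : K →ₗc[k] H}
    (h : IsRelativeRotaBaxter act τ) :
    ∃ G : HopfBrace k K,
      (∀ a b, G.mul a b = conv LinearMap.id (act.flip b ∘ₗ (τ : K →ₗ[k] H)) a) ∧
      IsRelativeRotaBaxter G.act (G.idEquiv : K →ₗc[k] G.Carrier) ∧
      IsBijectiveOneCocycle G.act G.idEquiv.symm := by
  let G := HopfBrace.ofAction h.hopfStructure τ h.moduleBialgebra.toIsModuleAlgebra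
    h.circHom_tmul
  have hτ (a b : K) : τ (G.mul a b) = τ a * τ b :=
    (congrArg τ (h.circHom_tmul a b)).trans (h.mul_eq a b).symm
  have hτ1 : τ 1 = 1 := by
    have := CoalgHom.congr_fun (congrArg ofConv (h.pointMap_one (C := K))) 1
    change τ (algebraMap k K (counit 1)) = algebraMap k H (counit (1 : K)) at this
    simpa using this
  have hG := G.isModuleBialgebra_act τ h.moduleBialgebra.toIsModuleAlgebra hτ hτ1 h.circHom_tmul
  exact ⟨G, h.circHom_tmul, G.isRelativeRotaBaxter_id hG, G.isBijectiveOneCocycle_id hG⟩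

theorem IsRotaBaxter.exists_hopfBrace {B : H →ₗc[k] H} (hB : IsRotaBaxter B) :
    ∃ G : HopfBrace k H,
      (∀ a b, G.mul a b = conv (LinearMap.mulRight k b ∘ₗ conv LinearMap.id (B : H →ₗ[k] H))
        (HopfAlgebra.antipode k ∘ₗ (B : H →ₗ[k] H)) a) ∧
      IsRelativeRotaBaxter G.act (G.idEquiv : H →ₗc[k] G.Carrier) ∧
      IsBijectiveOneCocycle G.act G.idEquiv.symm := by
  obtain ⟨G, hmul, hG⟩ := hB.isRelativeRotaBaxter.exists_hopfBrace
  exact ⟨G, fun a b => by rw [hmul, conv_id_adjointAct_flip_comp], hG⟩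

end Braces

end RBHopf

theorem proposition3p4 {k : Type u} [Field k] :
    -- from bijective 1-cocycles to relative Rota-Baxter operators
    (∀ (H : Type v) (K : Type w) [Ring H] [HopfAlgebra k H] [Coalgebra.IsCocomm k H]
        [Ring K] [HopfAlgebra k K] [Coalgebra.IsCocomm k K]
        (act : H →ₗ[k] K →ₗ[k] K) (π : H ≃ₗc[k] K), RBHopf.IsBijectiveOneCocycle act π →
      ∃ G : RBHopf.HopfBrace k K,
        (∀ a b, G.mul a b = π (π.symm a * π.symm b)) ∧
        RBHopf.IsRelativeRotaBaxter G.act (G.idEquiv : K →ₗc[k] G.Carrier)) ∧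
    -- from relative Rota-Baxter operators to bijective 1-cocycles
    (∀ (H : Type v) (K : Type w) [Ring H] [HopfAlgebra k H] [Coalgebra.IsCocomm k H]
        [Ring K] [HopfAlgebra k K] [Coalgebra.IsCocomm k K]
        (act : H →ₗ[k] K →ₗ[k] K) (τ : K →ₗc[k] H), RBHopf.IsRelativeRotaBaxter act τ →
      ∃ G : RBHopf.HopfBrace k K,
        (∀ a b, G.mul a b =
          RBHopf.conv LinearMap.id (act.flip b ∘ₗ (τ : K →ₗ[k] H)) a) ∧
        RBHopf.IsBijectiveOneCocycle G.act G.idEquiv.symm) ∧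
    -- cocommutative Rota-Baxter Hopf algebras
    (∀ (H : Type v) [Ring H] [HopfAlgebra k H] [Coalgebra.IsCocomm k H]
        (B : H →ₗc[k] H), RBHopf.IsRotaBaxter B →
      ∃ G : RBHopf.HopfBrace k H,
        (∀ a b, G.mul a b =
          RBHopf.conv (LinearMap.mulRight k b ∘ₗ RBHopf.conv LinearMap.id (B : H →ₗ[k] H))
            (HopfAlgebra.antipode k ∘ₗ (B : H →ₗ[k] H)) a) ∧
        RBHopf.IsRelativeRotaBaxter G.act (G.idEquiv : H →ₗc[k] G.Carrier) ∧
        RBHopf.IsBijectiveOneCocycle G.act G.idEquiv.symm) := ⟨fun _ _ _ _ _ _ _ _ _ _ h => h.exists_hopfBrace,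
    fun _ _ _ _ _ _ _ _ _ _ h =>
      let ⟨G, hmul, _, hG⟩ := h.exists_hopfBrace
      ⟨G, hmul, hG⟩,
    fun _ _ _ _ _ h => h.exists_hopfBrace⟩
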